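/- Arithmetic functions are functions $\mathbb N=\{1,2,\dots\}\to\mathbb C$; such a function $G$ is multiplicative if $G(ab)=G(a)G(b)$ for all coprime $a,b$. Let $c_q(a)=\sum_{1\le j\le q,\,(j,q)=1}\cos(2\pi ja/q)$ be the Ramanujan sum. For an arithmetic function $F$, let $\langle F\rangle_M$ be the set of multiplicative $G$ such that, for every $a\in\mathbb N$, the series $\sum_{q=1}^{\infty}G(q)c_q(a)$ converges (as the limit of its partial sums) to $F(a)$. For multiplicative $G$ and a prime $p$, let $w_{p,G}$ be the largest $w\ge1$ with $G(p^k)=G(p)^k$ for all $1\le k\le w$ ($w_{p,G}=\infty$ if there is no largest one). The prime $p$ is bad for $G$ if $1\le|G(p)|\le p$. If $G$ has finitely many bad primes, put $N_T(G)=\prod_p p^{w_{p,G}}$, the product running over the primes $p$ with $G(p)=1$ and $w_{p,G}\ne\infty$ (otherwise $N_T(G)=0$). The opacity core of $G$ is $H_G(q)=G(q\,N_T(G))\,\mu^2(q)$. For multiplicative $M\neq 0$, with $M'=M*\mu$ (Dirichlet convolution), the canonical Ramanujan coefficient of $M$ is $$G_M(q)=\prod_{p\mid q}\Bigl(1-\sum_{K=0}^{v_p(q)-1}\frac{M'(p^K)}{p^K}\Bigr).$$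 **Theorem.** Let $F$ be an arithmetic function that is not identically $0$, let $a_F=\min\{n: F(n)\ne0\}$ and $M_F(n)=F(a_Fn)/F(a_F)$. 1. If $G_1,G_2\in\langle F\rangle_M$ and $H_{G_1}=H_{G_2}$, then $G_1=G_2$. 2. Let $G\in\langle F\rangle_M$. Then $G$ has only finitely many bad primes (so that $N_T(G)\ge 1$ and $H_G$ is defined), and $F$ is semi-multiplicative in the standard form: $M_F$ is multiplicative, $F(n)=F(a_F)\,M_F(n/a_F)$ if $a_F\mid n$, and $F(n)=0$ otherwise. Moreover, for all primes $p$ and all $v\ge1$, $$G\bigl(p^{v_p(a_F)+v}\bigr)=H_G(p)+(1-H_G(p))\,G_{M_F}(p^v).$$ -/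

import Mathlib

open Filter Topology

/-! Functions `ℕ → ℂ` on the positive integers are modelled by Mathlib's `ArithmeticFunction ℂ`
(functions on `{0, 1, 2, …}` that vanish at `0`). -/

namespace Ramanujan

noncomputable section

/-- Multiplicative functions, the null function included (Mathlib's
`ArithmeticFunction.IsMultiplicative` excludes it). -/
def IsMult (G : ArithmeticFunction ℂ) : Prop :=
  ∀ a b : ℕ, a.Coprime b → G (a * b) = G a * G b

/-- The Ramanujan sum `c_q(a)`, the sum of `cos (2πja/q)` over `1 ≤ j ≤ q` with `(j,q) = 1`. -/
def ramanujanSum (q a : ℕ) : ℝ :=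
  ∑ j ∈ (Finset.Icc 1 q).filter (fun j => j.Coprime q),
    Real.cos (2 * Real.pi * (j : ℝ) * (a : ℝ) / (q : ℝ))

/-- The partial sum over `1 ≤ q ≤ N` of the Ramanujan series `∑ G(q) c_q(a)`. -/
def partialSum (G : ArithmeticFunction ℂ) (a N : ℕ) : ℂ :=
  ∑ q ∈ Finset.Icc 1 N, G q * (ramanujanSum q a : ℂ)

/-- The multiplicative Ramanujan cloud of `F`: the multiplicative `G` whose Ramanujan series
converges (possibly conditionally) to `F a` at every positive integer `a`. -/
def cloud (F : ArithmeticFunction ℂ) : Set (ArithmeticFunction ℂ) :=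
  {G | IsMult G ∧ ∀ a : ℕ, 0 < a → Tendsto (partialSum G a) atTop (𝓝 (F a))}

/-- The set of bad primes of `G`. -/
def badPrimes (G : ArithmeticFunction ℂ) : Set ℕ :=
  {p | p.Prime ∧ 1 ≤ ‖G p‖ ∧ ‖G p‖ ≤ (p : ℝ)}

/-- The completely multiplicative index of `p` for `G`: the largest `w ≥ 1` such that
`G(p^k) = G(p)^k` for `1 ≤ k ≤ w`, and `⊤` if there is no largest one. -/
def cmIndex (p : ℕ) (G : ArithmeticFunction ℂ) : ℕ∞ :=
  ⨆ w ∈ {w : ℕ | 1 ≤ w ∧ ∀ k : ℕ, 1 ≤ k → k ≤ w → G (p ^ k) = G p ^ k}, (w : ℕ∞)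

/-- The simply transparent primes of `G`: the primes with `G p = 1` along whose powers `G` is not
completely multiplicative. -/
def simplyTransparentPrimes (G : ArithmeticFunction ℂ) : Set ℕ :=
  {p | p.Prime ∧ G p = 1 ∧ cmIndex p G ≠ ⊤}

open Classical in
/-- The transparency conductor of `G`; it is `0` if `G` has infinitely many bad primes.
Simply transparent primes are bad, so that the product is finite in the first case. -/
def transparencyConductor (G : ArithmeticFunction ℂ) : ℕ :=
  if (badPrimes G).Finite then
    ∏ᶠ p ∈ simplyTransparentPrimes G, p ^ (cmIndex p G).toNat
  else 0

/-- The opacity core `H_G(q) = G(q N_T(G)) μ²(q)` of `G`. -/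
def opacityCore (G : ArithmeticFunction ℂ) : ArithmeticFunction ℂ where
  toFun q := G (q * transparencyConductor G) * ((ArithmeticFunction.moebius q : ℤ) : ℂ) ^ 2
  map_zero' := by simp

/-- The threshold of `F ≠ 0`: the least positive integer at which `F` does not vanish. -/
def threshold (F : ArithmeticFunction ℂ) : ℕ :=
  sInf {n : ℕ | F n ≠ 0}

/-- The function `M_F(n) = F(a_F n) / F(a_F)`, the only one for which
`F(n) = F(a_F) M_F(n / a_F)` can hold for all multiples `n` of the threshold `a_F`. -/
def associated (F : ArithmeticFunction ℂ) : ArithmeticFunction ℂ where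
  toFun n := F (threshold F * n) / F (threshold F)
  map_zero' := by simp

/-- The Eratosthenes transform `f' = f ∗ μ`. -/
def eratosthenes (f : ArithmeticFunction ℂ) : ArithmeticFunction ℂ :=
  f * ((ArithmeticFunction.moebius : ArithmeticFunction ℤ) : ArithmeticFunction ℂ)

/-- The canonical Ramanujan coefficient of `M`: the product over the primes `p ∣ q` of
`1 - ∑_{0 ≤ K ≤ v_p(q) - 1} M'(p^K) / p^K`. -/
def canonicalCoeff (M : ArithmeticFunction ℂ) : ArithmeticFunction ℂ where
  toFun q := if q = 0 then 0 else
    ∏ p ∈ q.primeFactors,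
      (1 - ∑ K ∈ Finset.range (q.factorization p), eratosthenes M (p ^ K) / (p : ℂ) ^ K)
  map_zero' := by simp

end

end Ramanujan

namespace Ramanujan

/-! Put D(d) = ∑ G(dm) μ(m), and let D_N(d) be its partial sum over m ≤ N. Since c_q(a) = ∑ d μ(q/d)
over the common divisors d of a and q, the Ramanujan series of G at a has partial sums ∑_{d∣a} d
D_{N/d}(d). Induction on a then makes every D(d) converge, with F(a) = ∑_{d∣a} d D(d).

For p ∤ d, sorting m by divisibility by p gives D_N(p^v d) = G(p^v) C_N - G(p^(v+1)) C_{N/p}, where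
C sums over m prime to p. If G is completely multiplicative along p, then D(p^v d) = G(p)^v D(d).
Otherwise two of these relations determine C, which therefore converges, to r say, and D(p^v d) =
(G(p^v) - G(p^(v+1))) r. Either way D(p^v d) separates into a factor in v and a factor in d.

Hence D is supported on the multiples of N = N_T(G), and D(N) ≠ 0 because F ≠ 0. So a_F = N, and n
D(Nn)/D(N) is multiplicative and equals M_F'. With n = v_p(N), the relation (1 - H_G(p))
M_F'(p^K)/p^K = G(p^(n+K)) - G(p^(n+K+1)) telescopes to the explicit formula. Rigidity follows: G is
1 on prime powers dividing N = a_F, and the formula gives the others. -/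

theorem IsMult.isMultiplicative {G : ArithmeticFunction ℂ} (hG : IsMult G) (h1 : G 1 = 1) :
    G.IsMultiplicative :=
  ⟨h1, fun h => hG _ _ h⟩

theorem IsMult.map_one_of_ne_zero {G : ArithmeticFunction ℂ} (hG : IsMult G) (h : G ≠ 0) :
    G 1 = 1 := by
  have h1 : G 1 = G 1 * G 1 := by simpa using hG 1 1 (by simp)
  by_contra hne
  have h0 : G 1 = 0 := by
    by_contra h0
    exact hne (mul_left_cancel₀ h0 (by rw [← h1, mul_one]))
  refine h (ArithmeticFunction.ext fun n => ?_)
  have := hG n 1 (by simp)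
  simpa [h0] using this

/-! ### Ramanujan sums as divisor sums -/

theorem sum_cos_two_pi_mul_div (n a : ℕ) (hn : 0 < n) :
    ∑ j ∈ Finset.Icc 1 n, Real.cos (2 * Real.pi * (j : ℝ) * (a : ℝ) / (n : ℝ)) =
      if n ∣ a then (n : ℝ) else 0 := by
  have hn0 : n ≠ 0 := hn.ne'
  have hζ := Complex.isPrimitiveRoot_exp n hn0
  set ζ := Complex.exp (2 * Real.pi * Complex.I / n) with hζdef
  have hcos : ∀ j : ℕ, Real.cos (2 * Real.pi * (j : ℝ) * (a : ℝ) / (n : ℝ)) =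
      (((ζ ^ a) ^ j : ℂ)).re := by
    intro j
    rw [← Complex.exp_ofReal_mul_I_re, hζdef, ← Complex.exp_nat_mul, ← Complex.exp_nat_mul]
    congr 2
    push_cast
    ring
  have hshift : ∑ j ∈ Finset.Icc 1 n, (ζ ^ a) ^ j = ∑ j ∈ Finset.range n, (ζ ^ a) ^ j := by
    have h1 : (ζ ^ a) ^ n = 1 := by rw [← pow_mul, mul_comm, pow_mul, hζ.pow_eq_one, one_pow]
    have h2 := Finset.sum_range_succ (fun j => (ζ ^ a) ^ j) n
    rw [Finset.sum_range_succ'] at h2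
    simp only [pow_zero, h1, add_left_inj] at h2
    rw [← h2, Finset.range_eq_Ico, Finset.sum_Ico_add' (fun j => (ζ ^ a) ^ j) 0 n 1]
    rfl
  rw [Finset.sum_congr rfl fun j _ => hcos j, ← Complex.re_sum, hshift]
  split_ifs with h
  · rw [(hζ.pow_eq_one_iff_dvd a).2 h]
    simp
  · have hne : ζ ^ a ≠ 1 := fun h' => h ((hζ.pow_eq_one_iff_dvd a).1 h')
    have h1 : (ζ ^ a) ^ n = 1 := by rw [← pow_mul, mul_comm, pow_mul, hζ.pow_eq_one, one_pow]
    rw [geom_sum_eq hne, h1]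
    simp

theorem sum_Icc_filter_dvd {M : Type*} [AddCommMonoid M] (f : ℕ → M) (d n : ℕ) (hd : 0 < d) :
    ∑ j ∈ (Finset.Icc 1 n).filter (d ∣ ·), f j = ∑ j ∈ Finset.Icc 1 (n / d), f (d * j) := by
  symm
  refine Finset.sum_bij (fun j _ => d * j) ?_ ?_ ?_ ?_
  · intro j hj
    simp only [Finset.mem_Icc, Finset.mem_filter] at hj ⊢
    exact ⟨⟨Nat.mul_pos hd hj.1, by
      rw [mul_comm]; exact (Nat.le_div_iff_mul_le hd).1 hj.2⟩, dvd_mul_right _ _⟩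
  · intro i _ j _ h
    exact Nat.eq_of_mul_eq_mul_left hd h
  · intro j hj
    simp only [Finset.mem_Icc, Finset.mem_filter] at hj
    obtain ⟨⟨h1, h2⟩, k, rfl⟩ := hj
    refine ⟨k, ?_, rfl⟩
    simp only [Finset.mem_Icc]
    exact ⟨Nat.pos_of_mul_pos_left h1, (Nat.le_div_iff_mul_le hd).2 (by rwa [mul_comm])⟩
  · intros; rfl

/-- Möbius inversion detects (j, q) = 1. The multiples j of e then form a complete cosine sum modulo
q/e, which is q/e or 0. -/
theorem ramanujanSum_eq (q a : ℕ) (hq : 0 < q) :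
    ramanujanSum q a = ∑ e ∈ q.divisors with q / e ∣ a,
      (ArithmeticFunction.moebius e : ℝ) * ((q / e : ℕ) : ℝ) := by
  have hind : ∀ j : ℕ, (if j.Coprime q then (1 : ℝ) else 0) =
      ∑ e ∈ q.divisors with e ∣ j, (ArithmeticFunction.moebius e : ℝ) := by
    intro j
    have h := congrArg (fun f : ArithmeticFunction ℤ => f (j.gcd q))
      ArithmeticFunction.moebius_mul_coe_zeta
    simp only [ArithmeticFunction.coe_mul_zeta_apply, ArithmeticFunction.one_apply] at h
    have hdiv : (j.gcd q).divisors = q.divisors.filter (· ∣ j) := by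
      ext e
      simp only [Nat.mem_divisors, Finset.mem_filter, Nat.dvd_gcd_iff, ne_eq, Nat.gcd_eq_zero_iff]
      have := hq.ne'
      tauto
    rw [hdiv] at h
    have h' := congrArg (fun z : ℤ => (z : ℝ)) h
    push_cast at h'
    exact h'.symm
  unfold ramanujanSum
  calc
    _ = ∑ j ∈ Finset.Icc 1 q, ∑ e ∈ q.divisors,
        if e ∣ j then (ArithmeticFunction.moebius e : ℝ) *
          Real.cos (2 * Real.pi * (j : ℝ) * (a : ℝ) / (q : ℝ)) else 0 := by
      rw [Finset.sum_filter]
      refine Finset.sum_congr rfl fun j _ => ?_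
      rw [← Finset.sum_filter, ← Finset.sum_mul, ← hind j]
      split_ifs <;> simp
    _ = _ := by
      rw [Finset.sum_comm, Finset.sum_filter]
      refine Finset.sum_congr rfl fun e he => ?_
      have hed := Nat.dvd_of_mem_divisors he
      have he0 : 0 < e := Nat.pos_of_mem_divisors he
      rw [← Finset.sum_filter, ← Finset.mul_sum, sum_Icc_filter_dvd _ e q he0]
      have hqe : 0 < q / e := Nat.div_pos (Nat.le_of_dvd hq hed) he0
      have : ∀ j : ℕ, 2 * Real.pi * ((e * j : ℕ) : ℝ) * (a : ℝ) / (q : ℝ) =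
          2 * Real.pi * (j : ℝ) * (a : ℝ) / ((q / e : ℕ) : ℝ) := by
        intro j
        have he' : (e : ℝ) ≠ 0 := by exact_mod_cast he0.ne'
        have hq' : (q : ℝ) ≠ 0 := by exact_mod_cast hq.ne'
        rw [Nat.cast_div hed he']
        push_cast
        field_simp
      simp_rw [this]
      rw [sum_cos_two_pi_mul_div _ a hqe]
      split_ifs <;> simp

theorem ramanujanSum_eq_sum_divisors (q a : ℕ) (hq : 0 < q) (ha : 0 < a) :
    ramanujanSum q a = ∑ d ∈ a.divisors with d ∣ q,
      (d : ℝ) * (ArithmeticFunction.moebius (q / d) : ℝ) := by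
  have h := Nat.sum_div_divisors q (fun d => if d ∣ a then
    (ArithmeticFunction.moebius (q / d) : ℝ) * (d : ℝ) else 0)
  rw [ramanujanSum_eq q a hq, Finset.sum_filter]
  have hq0 := hq.ne'
  have ha0 := ha.ne'
  calc
    _ = ∑ d ∈ q.divisors, if q / d ∣ a then
        (ArithmeticFunction.moebius (q / (q / d)) : ℝ) * ((q / d : ℕ) : ℝ) else 0 := by
      refine Finset.sum_congr rfl fun d hd => ?_
      rw [Nat.div_div_self (Nat.dvd_of_mem_divisors hd) hq0]
    _ = ∑ d ∈ q.divisors with d ∣ a, (ArithmeticFunction.moebius (q / d) : ℝ) * (d : ℝ) := by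
      rw [h, Finset.sum_filter]
    _ = _ := by
      refine Finset.sum_congr ?_ fun d _ => mul_comm _ _
      ext d
      simp only [Finset.mem_filter, Nat.mem_divisors]
      tauto

/-! ### Reduction to the series ∑ G(dm) μ(m) -/

/-- The partial sums of the series `∑ G(dm) μ(m)`. -/
noncomputable def dilatedSum (G : ArithmeticFunction ℂ) (d N : ℕ) : ℂ :=
  ∑ m ∈ Finset.Icc 1 N, G (d * m) * (ArithmeticFunction.moebius m : ℂ)

theorem partialSum_eq_sum_dilatedSum (G : ArithmeticFunction ℂ) (a N : ℕ) (ha : 0 < a) :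
    partialSum G a N = ∑ d ∈ a.divisors, (d : ℂ) * dilatedSum G d (N / d) := by
  have h1 : partialSum G a N = ∑ q ∈ Finset.Icc 1 N, ∑ d ∈ a.divisors,
      if d ∣ q then G q * ((d : ℂ) * (ArithmeticFunction.moebius (q / d) : ℂ)) else 0 := by
    refine Finset.sum_congr rfl fun q hq => ?_
    rw [ramanujanSum_eq_sum_divisors q a (Finset.mem_Icc.1 hq).1 ha, ← Finset.sum_filter,
      ← Finset.mul_sum]
    push_cast
    rfl
  rw [h1, Finset.sum_comm]
  refine Finset.sum_congr rfl fun d hd => ?_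
  have hd0 := Nat.pos_of_mem_divisors hd
  rw [← Finset.sum_filter, sum_Icc_filter_dvd _ d N hd0, dilatedSum, Finset.mul_sum]
  refine Finset.sum_congr rfl fun m _ => ?_
  rw [Nat.mul_div_cancel_left m hd0]
  ring

theorem exists_tendsto_dilatedSum {F G : ArithmeticFunction ℂ}
    (h : ∀ a : ℕ, 0 < a → Tendsto (partialSum G a) atTop (𝓝 (F a))) (a : ℕ) (ha : 0 < a) :
    ∃ D : ℂ, Tendsto (dilatedSum G a) atTop (𝓝 D) := by
  induction a using Nat.strong_induction_on with
  | _ a ih =>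
    have ih' : ∀ d ∈ a.properDivisors, ∃ D : ℂ, Tendsto (dilatedSum G d) atTop (𝓝 D) :=
      fun d hd => ih d (Nat.mem_properDivisors.1 hd).2 (Nat.pos_of_mem_properDivisors hd)
    choose! D hD using ih'
    -- At cutoff a * N the term d = a is exactly a D_N(a), so solving for it gives convergence along
    -- all N, not just a subsequence.
    have hscale : Tendsto (fun N : ℕ => a * N) atTop atTop :=
      tendsto_id.const_mul_atTop' ha
    have hsum : Tendsto (fun N => ∑ d ∈ a.properDivisors, (d : ℂ) * dilatedSum G d (a * N / d))
        atTop (𝓝 (∑ d ∈ a.properDivisors, (d : ℂ) * D d)) := by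
      refine tendsto_finsetSum _ fun d hd => Tendsto.const_mul _ ?_
      exact (hD d hd).comp ((Nat.tendsto_div_const_atTop
        (Nat.pos_of_mem_properDivisors hd).ne').comp hscale)
    have ha' : (a : ℂ) ≠ 0 := by exact_mod_cast ha.ne'
    refine ⟨_, ((((h a ha).comp hscale).sub hsum).const_mul (a : ℂ)⁻¹).congr fun N => ?_⟩
    simp only [Function.comp]
    rw [partialSum_eq_sum_dilatedSum G a _ ha, ← Nat.insert_self_properDivisors ha.ne',
      Finset.sum_insert (by simp), Nat.mul_div_cancel_left N ha, add_sub_cancel_right,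
      inv_mul_cancel_left₀ ha']

/-- The sum of the series `∑ G(dm) μ(m)`, with value `0` at divergence. -/
noncomputable def dilatedLimit (G : ArithmeticFunction ℂ) (d : ℕ) : ℂ :=
  limUnder atTop (dilatedSum G d)

theorem tendsto_dilatedSum {F G : ArithmeticFunction ℂ} (hG : G ∈ cloud F) {a : ℕ} (ha : 0 < a) :
    Tendsto (dilatedSum G a) atTop (𝓝 (dilatedLimit G a)) :=
  tendsto_nhds_limUnder (exists_tendsto_dilatedSum hG.2 a ha)

theorem apply_eq_sum_dilatedLimit {F G : ArithmeticFunction ℂ} (hG : G ∈ cloud F) {a : ℕ}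
    (ha : 0 < a) : F a = ∑ d ∈ a.divisors, (d : ℂ) * dilatedLimit G d := by
  refine tendsto_nhds_unique (hG.2 a ha) ?_
  refine (tendsto_finsetSum _ fun d hd => Tendsto.const_mul _
    ((tendsto_dilatedSum hG (Nat.pos_of_mem_divisors hd)).comp
      (Nat.tendsto_div_const_atTop (Nat.pos_of_mem_divisors hd).ne'))).congr fun N => ?_
  exact (partialSum_eq_sum_dilatedSum G a N ha).symm

/-! ### Splitting off one prime -/

/-- The partial sums of `∑ G(dm) μ(m)` over the `m` prime to `p`. -/
noncomputable def coprimeSum (G : ArithmeticFunction ℂ) (p d N : ℕ) : ℂ :=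
  ∑ m ∈ Finset.Icc 1 N with ¬ p ∣ m, G (d * m) * (ArithmeticFunction.moebius m : ℂ)

theorem dilatedSum_prime_pow_mul {G : ArithmeticFunction ℂ} (hG : IsMult G) {p d : ℕ}
    (hp : p.Prime) (hd : ¬ p ∣ d) (v N : ℕ) :
    dilatedSum G (p ^ v * d) N =
      G (p ^ v) * coprimeSum G p d N - G (p ^ (v + 1)) * coprimeSum G p d (N / p) := by
  have hsplit : ∀ k m : ℕ, ¬ p ∣ m → G (p ^ k * d * m) = G (p ^ k) * G (d * m) := by
    intro k m hm
    rw [mul_assoc]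
    refine hG _ _ (Nat.Coprime.pow_left _ ((Nat.Prime.coprime_iff_not_dvd hp).2 ?_))
    rw [hp.dvd_mul]
    tauto
  rw [dilatedSum, ← Finset.sum_filter_add_sum_filter_not _ (p ∣ ·), add_comm, sub_eq_add_neg]
  congr 1
  · rw [coprimeSum, Finset.mul_sum]
    refine Finset.sum_congr rfl fun m hm => ?_
    rw [hsplit v m (Finset.mem_filter.1 hm).2, mul_assoc]
  · rw [sum_Icc_filter_dvd _ p N hp.pos, coprimeSum, Finset.sum_filter, Finset.mul_sum,
      ← Finset.sum_neg_distrib]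
    refine Finset.sum_congr rfl fun m hm => ?_
    split_ifs with hpm
    · have : ¬ Squarefree (p * m) := by
        intro hs
        exact hp.not_isUnit (hs p (mul_dvd_mul_left p hpm))
      simp [ArithmeticFunction.moebius_eq_zero_of_not_squarefree this]
    · have hcop : p.Coprime m := (Nat.Prime.coprime_iff_not_dvd hp).2 hpm
      rw [ArithmeticFunction.isMultiplicative_moebius.map_mul_of_coprime hcop,
        ArithmeticFunction.moebius_apply_prime hp,
        show p ^ v * d * (p * m) = p ^ (v + 1) * d * m by ring, hsplit (v + 1) m hpm]
      push_cast
      ring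

/-- The proportionality already holds between partial sums, so the coprime sums need not converge.
-/
theorem dilatedLimit_of_completelyMultiplicative {F G : ArithmeticFunction ℂ} (hG : G ∈ cloud F)
    {p : ℕ} (hp : p.Prime) (hcm : ∀ k, G (p ^ k) = G p ^ k) {d : ℕ} (hd : ¬ p ∣ d) (v : ℕ) :
    dilatedLimit G (p ^ v * d) = G p ^ v * dilatedLimit G d := by
  have hd0 : 0 < d := Nat.pos_of_ne_zero fun h => hd (h ▸ dvd_zero p)
  refine tendsto_nhds_unique (tendsto_dilatedSum hG (Nat.mul_pos (pow_pos hp.pos v) hd0)) ?_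
  refine ((tendsto_dilatedSum hG hd0).const_mul (G p ^ v)).congr fun N => ?_
  have h0 := dilatedSum_prime_pow_mul hG.1 hp hd 0 N
  rw [pow_zero, one_mul] at h0
  rw [h0, dilatedSum_prime_pow_mul hG.1 hp hd v N, hcm v, hcm (v + 1)]
  have h1 : G 1 = 1 := by simpa using hcm 0
  rw [h1, zero_add, pow_one]
  ring

theorem exists_dilatedLimit_eq_sub_mul {F G : ArithmeticFunction ℂ} (hG : G ∈ cloud F)
    (h1 : G 1 = 1) {p : ℕ} (hp : p.Prime) {w : ℕ} (hw : G (p ^ (w + 1)) ≠ G p * G (p ^ w))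
    {d : ℕ} (hd : ¬ p ∣ d) :
    ∃ r : ℂ, ∀ v, dilatedLimit G (p ^ v * d) = (G (p ^ v) - G (p ^ (v + 1))) * r := by
  have hd0 : 0 < d := Nat.pos_of_ne_zero fun h => hd (h ▸ dvd_zero p)
  have hlim : ∀ v, Tendsto (dilatedSum G (p ^ v * d)) atTop (𝓝 (dilatedLimit G (p ^ v * d))) :=
    fun v => tendsto_dilatedSum hG (Nat.mul_pos (pow_pos hp.pos v) hd0)
  have hdet := sub_ne_zero.2 hw
  obtain ⟨r, hr⟩ : ∃ r, Tendsto (coprimeSum G p d) atTop (𝓝 r) := by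
    -- Eliminate C_{N/p} from the relations for exponents 0 and w; the determinant is nonzero by
    -- `hw`.
    refine ⟨_, ((((hlim 0).const_mul (G (p ^ (w + 1)))).sub ((hlim w).const_mul (G p))).const_mul
      (G (p ^ (w + 1)) - G p * G (p ^ w))⁻¹).congr fun N => ?_⟩
    rw [dilatedSum_prime_pow_mul hG.1 hp hd 0 N, dilatedSum_prime_pow_mul hG.1 hp hd w N,
      pow_zero, h1, zero_add, pow_one]
    field_simp
    ring
  refine ⟨r, fun v => tendsto_nhds_unique (hlim v) ?_⟩
  rw [sub_mul]
  refine ((hr.const_mul (G (p ^ v))).sub ((hr.comp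
    (Nat.tendsto_div_const_atTop hp.ne_zero)).const_mul (G (p ^ (v + 1))))).congr fun N => ?_
  exact (dilatedSum_prime_pow_mul hG.1 hp hd v N).symm

/-! ### Bad primes and the transparency conductor -/

/-- The terms G(m) μ(m) of the convergent series D(1) tend to 0, and at a prime their modulus is
|G(p)|. -/
theorem badPrimes_finite {F G : ArithmeticFunction ℂ} (hG : G ∈ cloud F) :
    (badPrimes G).Finite := by
  have hlim := tendsto_dilatedSum hG one_pos
  have hdiff := (hlim.comp (tendsto_add_atTop_nat 1)).sub hlim
  rw [sub_self] at hdiff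
  have hterm : Tendsto (fun N => G (N + 1) * (ArithmeticFunction.moebius (N + 1) : ℂ)) atTop
      (𝓝 0) := by
    refine hdiff.congr fun N => ?_
    simp only [Function.comp, dilatedSum]
    rw [Finset.sum_Icc_succ_top (by omega)]
    simp
  have hterm' := (tendsto_add_atTop_iff_nat
    (f := fun N => G N * (ArithmeticFunction.moebius N : ℂ)) 1).1 hterm
  have hev := hterm'.norm.eventually_lt_const (by simp : ‖(0 : ℂ)‖ < 1)
  obtain ⟨n, hn⟩ := eventually_atTop.1 hev
  refine (Set.finite_lt_nat n).subset fun p hp => ?_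
  by_contra hnp
  have := hn p (not_lt.1 hnp)
  rw [ArithmeticFunction.moebius_apply_prime hp.1] at this
  simp only [Int.reduceNeg, Int.cast_neg, Int.cast_one, mul_neg, mul_one, norm_neg] at this
  exact absurd hp.2.1 (not_le.2 this)

theorem cmIndex_eq_top {G : ArithmeticFunction ℂ} {p : ℕ} (h1 : G 1 = 1) (h : cmIndex p G = ⊤)
    (k : ℕ) : G (p ^ k) = G p ^ k := by
  have hk : (k : ℕ∞) < cmIndex p G := h ▸ ENat.natCast_lt_top k
  simp only [cmIndex, lt_iSup_iff] at hk
  obtain ⟨u, hu, hku⟩ := hk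
  rcases Nat.eq_zero_or_pos k with rfl | hk0
  · simpa using h1
  · exact hu.2 k hk0 (by exact_mod_cast hku.le)

theorem cmIndex_ne_top {G : ArithmeticFunction ℂ} {p : ℕ} (h : cmIndex p G ≠ ⊤) :
    (∀ k, 1 ≤ k → k ≤ (cmIndex p G).toNat → G (p ^ k) = G p ^ k) ∧
      G (p ^ ((cmIndex p G).toNat + 1)) ≠ G p ^ ((cmIndex p G).toNat + 1) := by
  obtain ⟨w, hw⟩ := ENat.ne_top_iff_exists.1 h
  rw [← hw, ENat.toNat_natCast]
  have hle : ∀ k, 1 ≤ k → k ≤ w → G (p ^ k) = G p ^ k := by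
    intro k hk1 hkw
    have hlt : ((k - 1 : ℕ) : ℕ∞) < cmIndex p G := by
      rw [← hw]
      exact_mod_cast (by omega : k - 1 < w)
    simp only [cmIndex, lt_iSup_iff] at hlt
    obtain ⟨u, hu, hku⟩ := hlt
    have hku' : k - 1 < u := by exact_mod_cast hku
    exact hu.2 k hk1 (by omega)
  refine ⟨hle, fun heq => ?_⟩
  have hmem : w + 1 ∈ {w : ℕ | 1 ≤ w ∧ ∀ k : ℕ, 1 ≤ k → k ≤ w → G (p ^ k) = G p ^ k} := by
    refine ⟨by omega, fun k hk1 hk => ?_⟩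
    rcases Nat.lt_or_ge w k with hlt | hge
    · obtain rfl : k = w + 1 := by omega
      exact heq
    · exact hle k hk1 hge
  have : ((w + 1 : ℕ) : ℕ∞) ≤ cmIndex p G := le_iSup₂ (f := fun (w : ℕ)
    (_ : w ∈ {w : ℕ | 1 ≤ w ∧ ∀ k : ℕ, 1 ≤ k → k ≤ w → G (p ^ k) = G p ^ k}) => (w : ℕ∞)) _ hmem
  rw [← hw] at this
  have : w + 1 ≤ w := by exact_mod_cast this
  omega

theorem simplyTransparentPrimes_subset_badPrimes (G : ArithmeticFunction ℂ) :
    simplyTransparentPrimes G ⊆ badPrimes G := by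
  rintro p ⟨hp, h1, -⟩
  refine ⟨hp, by simp [h1], ?_⟩
  rw [h1, norm_one]
  exact_mod_cast hp.one_le

theorem transparencyConductor_eq_prod {G : ArithmeticFunction ℂ} (hbad : (badPrimes G).Finite) :
    transparencyConductor G =
      ∏ p ∈ (hbad.subset (simplyTransparentPrimes_subset_badPrimes G)).toFinset,
        p ^ (cmIndex p G).toNat := by
  rw [transparencyConductor, if_pos hbad, finprod_mem_eq_finite_toFinset_prod]

theorem transparencyConductor_ne_zero {G : ArithmeticFunction ℂ} (hbad : (badPrimes G).Finite) :
    transparencyConductor G ≠ 0 := by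
  rw [transparencyConductor_eq_prod hbad, Finset.prod_ne_zero_iff]
  intro p hp
  exact pow_ne_zero _ ((Set.Finite.mem_toFinset _).1 hp).1.ne_zero

open Classical in
theorem factorization_transparencyConductor {G : ArithmeticFunction ℂ}
    (hbad : (badPrimes G).Finite) (p : ℕ) :
    (transparencyConductor G).factorization p =
      if p ∈ simplyTransparentPrimes G then (cmIndex p G).toNat else 0 := by
  rw [transparencyConductor_eq_prod hbad, Nat.factorization_prod fun q hq =>
    pow_ne_zero _ ((Set.Finite.mem_toFinset _).1 hq).1.ne_zero, Finset.sum_apply']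
  have : ∀ q ∈ (hbad.subset (simplyTransparentPrimes_subset_badPrimes G)).toFinset,
      (q ^ (cmIndex q G).toNat).factorization p = if q = p then (cmIndex p G).toNat else 0 := by
    intro q hq
    rw [((Set.Finite.mem_toFinset _).1 hq).1.factorization_pow, Finsupp.single_apply]
    split_ifs with h
    · rw [h]
    · rfl
  rw [Finset.sum_congr rfl this, Finset.sum_ite_eq']
  simp

/-- Along the powers of `p`, either `G` is completely multiplicative and `p` does not divide the
conductor, or complete multiplicativity fails and the exponent `n` of `p` in the conductor is the
first one with `G (p ^ n) ≠ G (p ^ (n + 1))`. -/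
theorem completelyMultiplicative_or {G : ArithmeticFunction ℂ} (h1 : G 1 = 1)
    (hbad : (badPrimes G).Finite) {p : ℕ} (hp : p.Prime) :
    ((∀ k, G (p ^ k) = G p ^ k) ∧ (transparencyConductor G).factorization p = 0) ∨
    ((∃ w, G (p ^ (w + 1)) ≠ G p * G (p ^ w)) ∧
      (∀ k ≤ (transparencyConductor G).factorization p, G (p ^ k) = 1) ∧
      G (p ^ ((transparencyConductor G).factorization p + 1)) ≠ 1) := by
  classical
  rw [factorization_transparencyConductor hbad]
  by_cases htop : cmIndex p G = ⊤
  · exact Or.inl ⟨cmIndex_eq_top h1 htop, if_neg fun h => h.2.2 htop⟩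
  · obtain ⟨hle, hne⟩ := cmIndex_ne_top htop
    refine Or.inr ⟨⟨(cmIndex p G).toNat, fun h => hne ?_⟩, ?_⟩
    · rcases Nat.eq_zero_or_pos (cmIndex p G).toNat with h0 | hpos
      · simp [h0]
      · rw [h, hle _ hpos le_rfl, pow_succ']
    -- If G(p) ≠ 1, the conductor has exponent 0 at p, and the first change of value is already from
    -- G(1) = 1 to G(p).
    · by_cases hGp : G p = 1
      · rw [if_pos ⟨hp, hGp, htop⟩]
        refine ⟨fun k hk => ?_, by simpa [hGp] using hne⟩
        rcases Nat.eq_zero_or_pos k with rfl | hk0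
        · simpa using h1
        · rw [hle k hk0 hk, hGp, one_pow]
      · rw [if_neg fun h => hGp h.2.1]
        refine ⟨fun k hk => ?_, by simpa using hGp⟩
        rw [Nat.le_zero.1 hk, pow_zero, h1]

theorem apply_prime_pow_eq_one {G : ArithmeticFunction ℂ} (h1 : G 1 = 1)
    (hbad : (badPrimes G).Finite) {p : ℕ} (hp : p.Prime) {k : ℕ}
    (hk : k ≤ (transparencyConductor G).factorization p) : G (p ^ k) = 1 := by
  rcases completelyMultiplicative_or h1 hbad hp with ⟨-, h0⟩ | ⟨-, h, -⟩
  · rw [h0] at hk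
    rw [Nat.le_zero.1 hk, pow_zero, h1]
  · exact h k hk

theorem apply_eq_one_of_dvd_transparencyConductor {G : ArithmeticFunction ℂ} (hG : IsMult G)
    (h1 : G 1 = 1) (hbad : (badPrimes G).Finite) {m : ℕ} (hm : m ∣ transparencyConductor G) :
    G m = 1 := by
  have hN := transparencyConductor_ne_zero hbad
  have hm0 : m ≠ 0 := fun h => hN (zero_dvd_iff.1 (h ▸ hm))
  rw [ArithmeticFunction.IsMultiplicative.multiplicative_factorization G
    (hG.isMultiplicative h1) hm0]
  exact Finset.prod_eq_one fun p hp => apply_prime_pow_eq_one h1 hbad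
    (Nat.prime_of_mem_primeFactors hp) ((Nat.factorization_le_iff_dvd hm0 hN).2 hm p)

theorem opacityCore_prime {G : ArithmeticFunction ℂ} (hG : IsMult G) (h1 : G 1 = 1)
    (hbad : (badPrimes G).Finite) {p : ℕ} (hp : p.Prime) :
    opacityCore G p = G (p ^ ((transparencyConductor G).factorization p + 1)) := by
  have hN := transparencyConductor_ne_zero hbad
  change G (p * transparencyConductor G) * _ = _
  rw [ArithmeticFunction.moebius_apply_prime hp]
  conv_lhs => rw [← Nat.ordProj_mul_ordCompl_eq_self (transparencyConductor G) p]
  rw [← mul_assoc, ← pow_succ', hG _ _ ((Nat.coprime_ordCompl hp hN).pow_left _),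
    apply_eq_one_of_dvd_transparencyConductor hG h1 hbad (Nat.ordCompl_dvd _ _)]
  simp

/-! ### Dependence of the limits on the exponent of one prime -/

section

variable {F G : ArithmeticFunction ℂ} (hG : G ∈ cloud F) (h1 : G 1 = 1) {p : ℕ} (hp : p.Prime)
include hG h1 hp

/-- Free of division because the factor 1 - H_G(p) can vanish, namely when G is completely
multiplicative along p with G(p) = 1. -/
theorem one_sub_mul_dilatedLimit {d : ℕ} (hd : ¬ p ∣ d) (K : ℕ) :
    (1 - G (p ^ ((transparencyConductor G).factorization p + 1))) *
        dilatedLimit G (p ^ ((transparencyConductor G).factorization p + K) * d) =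
      (G (p ^ ((transparencyConductor G).factorization p + K)) -
        G (p ^ ((transparencyConductor G).factorization p + K + 1))) *
          dilatedLimit G (p ^ (transparencyConductor G).factorization p * d) := by
  rcases completelyMultiplicative_or h1 (badPrimes_finite hG) hp with ⟨hcm, h0⟩ | ⟨⟨w, hw⟩, h, -⟩
  · rw [h0, dilatedLimit_of_completelyMultiplicative hG hp hcm hd,
      dilatedLimit_of_completelyMultiplicative hG hp hcm hd, hcm, hcm, hcm]
    simp only [zero_add, pow_zero, pow_succ]
    ring
  · obtain ⟨r, hr⟩ := exists_dilatedLimit_eq_sub_mul hG h1 hp hw hd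
    rw [hr, hr, h _ le_rfl]
    ring

/-- The array D(p^u d), indexed by u and d, has rank at most one, so its 2 × 2 minors vanish. -/
theorem dilatedLimit_mul_comm {d e : ℕ} (hd : ¬ p ∣ d) (he : ¬ p ∣ e) (u v : ℕ) :
    dilatedLimit G (p ^ u * d) * dilatedLimit G (p ^ v * e) =
      dilatedLimit G (p ^ u * e) * dilatedLimit G (p ^ v * d) := by
  rcases completelyMultiplicative_or h1 (badPrimes_finite hG) hp with ⟨hcm, -⟩ | ⟨⟨w, hw⟩, -⟩
  · simp only [dilatedLimit_of_completelyMultiplicative hG hp hcm hd,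
      dilatedLimit_of_completelyMultiplicative hG hp hcm he]
    ring
  · obtain ⟨r, hr⟩ := exists_dilatedLimit_eq_sub_mul hG h1 hp hw hd
    obtain ⟨s, hs⟩ := exists_dilatedLimit_eq_sub_mul hG h1 hp hw he
    simp only [hr, hs]
    ring

/-- When complete multiplicativity fails, G(p^v) - G(p^(v+1)) vanishes below the exponent of p in
the conductor and is nonzero at it. -/
theorem dilatedLimit_prime_pow_mul_ne_zero {d v : ℕ} (hd : ¬ p ∣ d)
    (hne : dilatedLimit G (p ^ v * d) ≠ 0) :
    (transparencyConductor G).factorization p ≤ v ∧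
      dilatedLimit G (p ^ (transparencyConductor G).factorization p * d) ≠ 0 := by
  rcases completelyMultiplicative_or h1 (badPrimes_finite hG) hp with
    ⟨hcm, h0⟩ | ⟨⟨w, hw⟩, h, hne1⟩
  · rw [dilatedLimit_of_completelyMultiplicative hG hp hcm hd] at hne
    rw [h0, pow_zero, one_mul]
    exact ⟨Nat.zero_le _, right_ne_zero_of_mul hne⟩
  · obtain ⟨r, hr⟩ := exists_dilatedLimit_eq_sub_mul hG h1 hp hw hd
    rw [hr] at hne
    rw [hr, h _ le_rfl]
    refine ⟨?_, mul_ne_zero (sub_ne_zero.2 hne1.symm) (right_ne_zero_of_mul hne)⟩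
    by_contra! hlt
    exact hne (by rw [h v hlt.le, h (v + 1) hlt, sub_self, zero_mul])

end

/-! ### Support of the limits -/

section

variable {F G : ArithmeticFunction ℂ} (hG : G ∈ cloud F) (h1 : G 1 = 1)
include hG h1

theorem transparencyConductor_dvd {d : ℕ} (hd : d ≠ 0) (hne : dilatedLimit G d ≠ 0) :
    transparencyConductor G ∣ d := by
  rw [← Nat.factorization_le_iff_dvd (transparencyConductor_ne_zero (badPrimes_finite hG)) hd]
  intro p
  by_cases hp : p.Prime
  · rw [← Nat.ordProj_mul_ordCompl_eq_self d p] at hne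
    exact (dilatedLimit_prime_pow_mul_ne_zero hG h1 hp (Nat.not_dvd_ordCompl hp hd) hne).1
  · simp [Nat.factorization_eq_zero_of_not_prime _ hp]

/-- The least d with D(d) ≠ 0 is the conductor: lowering the exponent of a prime to its exponent
there keeps D nonzero. -/
theorem dilatedLimit_transparencyConductor_ne_zero (hex : ∃ d, d ≠ 0 ∧ dilatedLimit G d ≠ 0) :
    dilatedLimit G (transparencyConductor G) ≠ 0 := by
  classical
  obtain ⟨hd, hne⟩ := Nat.find_spec hex
  set d := Nat.find hex with hd_def
  suffices h : transparencyConductor G = d by rwa [h]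
  refine Nat.eq_of_factorization_eq (transparencyConductor_ne_zero (badPrimes_finite hG)) hd
    fun p => ?_
  by_cases hp : p.Prime
  · have hne' := hne
    rw [← Nat.ordProj_mul_ordCompl_eq_self d p] at hne'
    obtain ⟨hle, hne2⟩ := dilatedLimit_prime_pow_mul_ne_zero hG h1 hp
      (Nat.not_dvd_ordCompl hp hd) hne'
    have hpos := Nat.ordCompl_pos p hd
    have hmin := Nat.find_min' hex ⟨Nat.mul_ne_zero (pow_ne_zero _ hp.ne_zero) hpos.ne', hne2⟩
    rw [← hd_def] at hmin
    refine le_antisymm hle ?_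
    conv_lhs at hmin => rw [← Nat.ordProj_mul_ordCompl_eq_self d p]
    exact (Nat.pow_le_pow_iff_right hp.one_lt).1 (Nat.le_of_mul_le_mul_right hmin hpos)
  · simp [Nat.factorization_eq_zero_of_not_prime _ hp]

theorem apply_transparencyConductor_mul {n : ℕ} (hn : n ≠ 0) :
    F (transparencyConductor G * n) = ∑ d ∈ n.divisors,
      ((transparencyConductor G * d : ℕ) : ℂ) * dilatedLimit G (transparencyConductor G * d) := by
  have hN := transparencyConductor_ne_zero (badPrimes_finite hG)
  rw [apply_eq_sum_dilatedLimit hG (Nat.pos_of_ne_zero (mul_ne_zero hN hn))]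
  symm
  refine Finset.sum_of_injOn (fun d => transparencyConductor G * d)
    (fun a _ b _ h => Nat.eq_of_mul_eq_mul_left (Nat.pos_of_ne_zero hN) h) ?_ ?_ ?_
  · intro d hd
    simp only [Finset.mem_coe, Nat.mem_divisors] at hd ⊢
    exact ⟨mul_dvd_mul_left _ hd.1, mul_ne_zero hN hn⟩
  · intro d hd hnot
    by_contra hne
    obtain ⟨e, rfl⟩ := transparencyConductor_dvd hG h1 (Nat.pos_of_mem_divisors hd).ne'
      (right_ne_zero_of_mul hne)
    exact hnot ⟨e, Nat.mem_divisors.2 ⟨(Nat.mul_dvd_mul_iff_left (Nat.pos_of_ne_zero hN)).1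
      (Nat.dvd_of_mem_divisors hd), hn⟩, rfl⟩
  · intros; rfl

theorem transparencyConductor_dvd_of_apply_ne_zero {n : ℕ} (hne : F n ≠ 0) :
    transparencyConductor G ∣ n := by
  have hn : n ≠ 0 := fun h => hne (by rw [h, ArithmeticFunction.map_zero])
  rw [apply_eq_sum_dilatedLimit hG (Nat.pos_of_ne_zero hn)] at hne
  obtain ⟨d, hd, hd'⟩ := Finset.exists_ne_zero_of_sum_ne_zero hne
  exact (transparencyConductor_dvd hG h1 (Nat.pos_of_mem_divisors hd).ne'
    (right_ne_zero_of_mul hd')).trans (Nat.dvd_of_mem_divisors hd)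

end

theorem map_one_of_mem_cloud {F G : ArithmeticFunction ℂ} (hF : F ≠ 0) (hG : G ∈ cloud F) :
    G 1 = 1 := by
  refine hG.1.map_one_of_ne_zero ?_
  rintro rfl
  refine hF (ArithmeticFunction.ext fun n => ?_)
  rcases Nat.eq_zero_or_pos n with rfl | hn
  · simp
  · refine tendsto_nhds_unique (hG.2 n hn) (tendsto_const_nhds.congr fun N => ?_)
    simp [partialSum]

/-! ### Threshold, multiplicativity and the explicit formula -/

section

variable {F G : ArithmeticFunction ℂ} (hF : F ≠ 0) (hG : G ∈ cloud F)
include hF hG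

theorem dilatedLimit_conductor_ne_zero :
    dilatedLimit G (transparencyConductor G) ≠ 0 := by
  refine dilatedLimit_transparencyConductor_ne_zero hG (map_one_of_mem_cloud hF hG) ?_
  by_contra! h
  refine hF (ArithmeticFunction.ext fun n => ?_)
  rcases Nat.eq_zero_or_pos n with rfl | hn
  · simp
  · rw [apply_eq_sum_dilatedLimit hG hn]
    exact Finset.sum_eq_zero fun d hd => by rw [h d (Nat.pos_of_mem_divisors hd).ne', mul_zero]

theorem apply_conductor : F (transparencyConductor G) =
    transparencyConductor G * dilatedLimit G (transparencyConductor G) := by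
  simpa using apply_transparencyConductor_mul hG (map_one_of_mem_cloud hF hG) one_ne_zero

theorem threshold_eq_transparencyConductor : threshold F = transparencyConductor G := by
  have hN := transparencyConductor_ne_zero (badPrimes_finite hG)
  have hmem : transparencyConductor G ∈ {n : ℕ | F n ≠ 0} := by
    change F _ ≠ 0
    rw [apply_conductor hF hG]
    exact mul_ne_zero (by exact_mod_cast hN) (dilatedLimit_conductor_ne_zero hF hG)
  refine le_antisymm (Nat.sInf_le hmem) ?_
  have hthr : F (threshold F) ≠ 0 := Nat.sInf_mem ⟨_, hmem⟩
  refine Nat.le_of_dvd (Nat.pos_of_ne_zero fun h => hthr ?_)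
    (transparencyConductor_dvd_of_apply_ne_zero hG (map_one_of_mem_cloud hF hG) hthr)
  rw [h, ArithmeticFunction.map_zero]

theorem dilatedLimit_conductor_prime_pow_mul {p d : ℕ} (hp : p.Prime) (hd : ¬ p ∣ d) (k : ℕ) :
    dilatedLimit G (transparencyConductor G * (p ^ k * d)) *
        dilatedLimit G (transparencyConductor G) =
      dilatedLimit G (transparencyConductor G * p ^ k) *
        dilatedLimit G (transparencyConductor G * d) := by
  have hN := transparencyConductor_ne_zero (badPrimes_finite hG)
  have hN' := Nat.not_dvd_ordCompl hp hN
  -- The vanishing minor with exponents n + k and n, where n = v_p(N), and cofactors N'd and N',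
  -- where N' is the part of N prime to p.
  have key := dilatedLimit_mul_comm hG (map_one_of_mem_cloud hF hG) hp
    (d := ordCompl[p] (transparencyConductor G) * d) (e := ordCompl[p] (transparencyConductor G))
    (by rw [hp.dvd_mul]; tauto) hN'
    ((transparencyConductor G).factorization p + k) ((transparencyConductor G).factorization p)
  have hself := Nat.ordProj_mul_ordCompl_eq_self (transparencyConductor G) p
  generalize ordCompl[p] (transparencyConductor G) = N' at *
  generalize (transparencyConductor G).factorization p = n at *
  rw [← hself]
  convert key using 3 <;> ring

/-- The normalised limits `n D(Nn) / D(N)`, where `D(d) = ∑ G(dm) μ(m)` and `N` is the transparency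
conductor of `G`. -/
noncomputable def normalizedLimit (G : ArithmeticFunction ℂ) : ArithmeticFunction ℂ where
  toFun n := n * (dilatedLimit G (transparencyConductor G * n) /
    dilatedLimit G (transparencyConductor G))
  map_zero' := by simp

omit hF hG in
theorem normalizedLimit_apply (G : ArithmeticFunction ℂ) (n : ℕ) : normalizedLimit G n =
    n * (dilatedLimit G (transparencyConductor G * n) /
      dilatedLimit G (transparencyConductor G)) := rfl

theorem normalizedLimit_isMultiplicative : (normalizedLimit G).IsMultiplicative := by
  have hD := dilatedLimit_conductor_ne_zero hF hG
  have hone : normalizedLimit G 1 = 1 := by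
    simp [normalizedLimit_apply, hD]
  have hstep : ∀ p d k : ℕ, p.Prime → ¬ p ∣ d →
      normalizedLimit G (p ^ k * d) = normalizedLimit G (p ^ k) * normalizedLimit G d := by
    intro p d k hp hd
    have := dilatedLimit_conductor_prime_pow_mul hF hG hp hd k
    simp only [normalizedLimit_apply]
    push_cast
    field_simp
    linear_combination ((p : ℂ) ^ k * d) * this
  refine ⟨hone, fun {a b} hab => ?_⟩
  induction a using Nat.recOnPrimePow with
  | zero =>
    simp
  | one => simp [hone]
  | prime_pow_mul a p k hp hpa hk ih =>
    have hpb : ¬ p ∣ b := (Nat.Prime.coprime_iff_not_dvd hp).1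
      ((hab.coprime_dvd_left (dvd_mul_right _ _)).coprime_dvd_left (dvd_pow_self p hk.ne'))
    rw [mul_assoc, hstep p (a * b) k hp (by rw [hp.dvd_mul]; tauto), hstep p a k hp hpa,
      ih (hab.coprime_dvd_left (dvd_mul_left _ _)), mul_assoc]

theorem associated_eq : associated F =
    (ArithmeticFunction.zeta : ArithmeticFunction ℂ) * normalizedLimit G := by
  have hD := dilatedLimit_conductor_ne_zero hF hG
  have hN : (transparencyConductor G : ℂ) ≠ 0 := by
    exact_mod_cast transparencyConductor_ne_zero (badPrimes_finite hG)
  refine ArithmeticFunction.ext fun n => ?_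
  rcases eq_or_ne n 0 with rfl | hn
  · simp
  change F (threshold F * n) / F (threshold F) = _
  rw [threshold_eq_transparencyConductor hF hG, ArithmeticFunction.coe_zeta_mul_apply,
    apply_transparencyConductor_mul hG (map_one_of_mem_cloud hF hG) hn, apply_conductor hF hG,
    Finset.sum_div]
  refine Finset.sum_congr rfl fun d _ => ?_
  rw [normalizedLimit_apply]
  push_cast
  field_simp

theorem eratosthenes_associated : eratosthenes (associated F) = normalizedLimit G := by
  rw [eratosthenes, associated_eq hF hG, mul_comm, ← mul_assoc,
    ArithmeticFunction.coe_moebius_mul_coe_zeta, one_mul]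

theorem associated_isMult : IsMult (associated F) := by
  rw [associated_eq hF hG]
  exact fun a b h => (ArithmeticFunction.isMultiplicative_zeta.natCast.mul
    (normalizedLimit_isMultiplicative hF hG)).map_mul_of_coprime h

theorem apply_eq_threshold_mul (n : ℕ) : F n = F (threshold F) *
    (if threshold F ∣ n then associated F (n / threshold F) else 0) := by
  have hthr : F (threshold F) ≠ 0 := by
    rw [threshold_eq_transparencyConductor hF hG, apply_conductor hF hG]
    exact mul_ne_zero (by exact_mod_cast transparencyConductor_ne_zero (badPrimes_finite hG))
      (dilatedLimit_conductor_ne_zero hF hG)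
  split_ifs with h
  · change _ = _ * (F (threshold F * (n / threshold F)) / F (threshold F))
    rw [Nat.mul_div_cancel' h, mul_div_cancel₀ _ hthr]
  · rw [mul_zero]
    by_contra hne
    rw [threshold_eq_transparencyConductor hF hG] at h
    exact h (transparencyConductor_dvd_of_apply_ne_zero hG (map_one_of_mem_cloud hF hG) hne)

theorem apply_prime_pow_eq {p : ℕ} (hp : p.Prime) {v : ℕ} (hv : 1 ≤ v) :
    G (p ^ (padicValNat p (threshold F) + v)) =
      opacityCore G p + (1 - opacityCore G p) * canonicalCoeff (associated F) (p ^ v) := by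
  have h1 := map_one_of_mem_cloud hF hG
  have hbad := badPrimes_finite hG
  have hN := transparencyConductor_ne_zero hbad
  have hD := dilatedLimit_conductor_ne_zero hF hG
  -- Each summand of the canonical coefficient, times 1 - H_G(p), is a difference of consecutive
  -- values of G, so the sum telescopes to G(p^n) - G(p^(n+v)) with G(p^n) = 1.
  have hterm : ∀ K, (1 - G (p ^ ((transparencyConductor G).factorization p + 1))) *
      (normalizedLimit G (p ^ K) / (p : ℂ) ^ K) =
      G (p ^ ((transparencyConductor G).factorization p + K)) -
        G (p ^ ((transparencyConductor G).factorization p + (K + 1))) := by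
    intro K
    have key := one_sub_mul_dilatedLimit hG h1 hp (Nat.not_dvd_ordCompl hp hN) K
    have hp0 : (p : ℂ) ≠ 0 := by exact_mod_cast hp.ne_zero
    rw [pow_add p _ K, mul_right_comm (p ^ _) (p ^ K), Nat.ordProj_mul_ordCompl_eq_self, ← pow_add,
      add_assoc] at key
    rw [normalizedLimit_apply]
    push_cast
    field_simp
    linear_combination key
  have hcoeff : canonicalCoeff (associated F) (p ^ v) =
      1 - ∑ K ∈ Finset.range v, normalizedLimit G (p ^ K) / (p : ℂ) ^ K := by
    change (if p ^ v = 0 then 0 else _) = _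
    rw [if_neg (pow_ne_zero _ hp.ne_zero), Nat.primeFactors_prime_pow (by omega) hp,
      Finset.prod_singleton, hp.factorization_pow, Finsupp.single_eq_same,
      eratosthenes_associated hF hG]
  rw [threshold_eq_transparencyConductor hF hG, ← Nat.factorization_def _ hp,
    opacityCore_prime hG.1 h1 hbad hp, hcoeff, mul_sub, Finset.mul_sum,
    Finset.sum_congr rfl fun K _ => hterm K,
    Finset.sum_range_sub' fun K => G (p ^ ((transparencyConductor G).factorization p + K)),
    add_zero, apply_prime_pow_eq_one h1 hbad hp le_rfl]
  ring

end

/-- Both conductors equal the threshold of F, so the prime powers where the value is forced to be 1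
are the same for both functions. -/
theorem eq_of_opacityCore_eq {F G₁ G₂ : ArithmeticFunction ℂ} (hF : F ≠ 0) (hG₁ : G₁ ∈ cloud F)
    (hG₂ : G₂ ∈ cloud F) (h : opacityCore G₁ = opacityCore G₂) : G₁ = G₂ := by
  have h1 := map_one_of_mem_cloud hF hG₁
  have h2 := map_one_of_mem_cloud hF hG₂
  have hN : transparencyConductor G₁ = transparencyConductor G₂ :=
    (threshold_eq_transparencyConductor hF hG₁).symm.trans
      (threshold_eq_transparencyConductor hF hG₂)
  rw [ArithmeticFunction.IsMultiplicative.eq_iff_eq_on_prime_powers _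
    (hG₁.1.isMultiplicative h1) _ (hG₂.1.isMultiplicative h2)]
  intro p k hp
  rcases Nat.lt_or_ge ((transparencyConductor G₁).factorization p) k with hlt | hge
  · obtain ⟨v, rfl⟩ := Nat.exists_eq_add_of_lt hlt
    have e1 := apply_prime_pow_eq hF hG₁ hp (Nat.le_add_left 1 v)
    have e2 := apply_prime_pow_eq hF hG₂ hp (Nat.le_add_left 1 v)
    rw [threshold_eq_transparencyConductor hF hG₁, ← Nat.factorization_def _ hp] at e1 e2
    rw [add_assoc, e1, e2, h]
  · rw [apply_prime_pow_eq_one h1 (badPrimes_finite hG₁) hp hge,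
      apply_prime_pow_eq_one h2 (badPrimes_finite hG₂) hp (hN ▸ hge)]

end Ramanujan

theorem theorem9p3 (F : ArithmeticFunction ℂ) (hF : F ≠ 0) :
    -- rigidity
    (∀ G₁ ∈ Ramanujan.cloud F, ∀ G₂ ∈ Ramanujan.cloud F,
      Ramanujan.opacityCore G₁ = Ramanujan.opacityCore G₂ → G₁ = G₂) ∧
    -- explicit formula, together with the facts that give its terms a meaning
    (∀ G ∈ Ramanujan.cloud F,
      (Ramanujan.badPrimes G).Finite ∧
      (Ramanujan.IsMult (Ramanujan.associated F) ∧
        ∀ n : ℕ, F n = F (Ramanujan.threshold F) *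
          (if Ramanujan.threshold F ∣ n
            then Ramanujan.associated F (n / Ramanujan.threshold F) else 0)) ∧
      ∀ p : ℕ, p.Prime → ∀ v : ℕ, 1 ≤ v →
        G (p ^ (padicValNat p (Ramanujan.threshold F) + v)) =
          Ramanujan.opacityCore G p + (1 - Ramanujan.opacityCore G p) *
            Ramanujan.canonicalCoeff (Ramanujan.associated F) (p ^ v)) := by
  refine ⟨fun G₁ h₁ G₂ h₂ h => Ramanujan.eq_of_opacityCore_eq hF h₁ h₂ h, fun G hG => ?_⟩
  exact ⟨Ramanujan.badPrimes_finite hG,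
    ⟨Ramanujan.associated_isMult hF hG, Ramanujan.apply_eq_threshold_mul hF hG⟩,
    fun p hp v hv => Ramanujan.apply_prime_pow_eq hF hG hp hv⟩
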